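/- A category $\mathcal{C}$ is said to have pairwise coproducts (respectively, pairwise products) if any two objects $c_1, c_2$ of $\mathcal{C}$ have a coproduct $c_1 \sqcup c_2$ (respectively, a product $c_1 \times c_2$) in $\mathcal{C}$; an initial or terminal object is not required. The classifying space $B\mathcal{C}$ of a small category $\mathcal{C}$ is the geometric realisation of its nerve, and $\mathcal{C}$ is called contractible if the topological space $B\mathcal{C}$ is contractible, i.e. homotopy equivalent to a point. Proposition. Let $\mathcal{C}$ be a non-empty small category. If $\mathcal{C}$ has pairwise coproducts, then $\mathcal{C}$ is contractible. Likewise, if $\mathcal{C}$ has pairwise products, then $\mathcal{C}$ is contractible. -/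

import Mathlib

universe v u

open CategoryTheory CategoryTheory.Limits

/-- The classifying space of a category: the geometric realization of its nerve. -/
noncomputable def CategoryTheory.ClassifyingSpace (C : Type u) [Category.{v} C] :
    TopCat.{max u v} :=
  SSet.toTop.obj (nerve C)

/-- A category is contractible if its classifying space is a contractible topological space. -/
def CategoryTheory.IsContractibleCategory (C : Type u) [Category.{v} C] : Prop :=
  ContractibleSpace (ClassifyingSpace C)

/-! Fix an object `c`. The coproduct inclusions are natural transformations from the identity and
from the constant functor at `c` to `c ⨿ -`; for products, the projections point the other way. A
natural transformation realises to a homotopy (`homotopic_of_natTrans`), so the identity of the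
classifying space is homotopic to a constant map.

The analytic core is `homotopic_toTop_map`. A simplicial homotopy X ⊗ Δ[1] ⟶ Y becomes a map from
|X| to the path space C(I, |Y|), defined simplex by simplex after cutting each prism Δⁿ × I into n +
1 simplices. Aiming at the path space avoids comparing |X ⊗ Δ[1]| with |X| × I. -/

section Realization

open Simplicial Opposite MonoidalCategory

/-! ### Points of a realization and maps out of it. -/

namespace GeometricRealization

variable {X Y : SSet.{u}}

/-- The point of the realization of `X` with barycentric coordinates `t` in the simplex `x`. -/
noncomputable def realizationPoint {n : SimplexCategory} (x : X.obj (op n))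
    (t : stdSimplex ℝ (Fin (n.len + 1))) : |X| :=
  TopCat.toSSetObjEquiv |X| (op n) ((sSetTopAdj.unit.app X).app (op n) x) t

lemma continuous_realizationPoint {n : SimplexCategory} (x : X.obj (op n)) :
    Continuous (realizationPoint x) :=
  (TopCat.toSSetObjEquiv |X| (op n) ((sSetTopAdj.unit.app X).app (op n) x)).continuous

lemma realizationPoint_map {m n : SimplexCategory} (f : m ⟶ n) (x : X.obj (op n))
    (t : stdSimplex ℝ (Fin (m.len + 1))) :
    realizationPoint (X.map f.op x) t = realizationPoint x (stdSimplex.map f t) := by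
  have h := ConcreteCategory.congr_hom ((sSetTopAdj.unit.app X).naturality f.op) x
  dsimp at h
  simp only [realizationPoint]
  rw [h]
  rfl

lemma toTop_map_realizationPoint (f : X ⟶ Y) {n : SimplexCategory} (x : X.obj (op n))
    (t : stdSimplex ℝ (Fin (n.len + 1))) :
    SSet.toTop.map f (realizationPoint x t) = realizationPoint (f.app (op n) x) t := by
  have h := ConcreteCategory.congr_hom (congr_app (sSetTopAdj.unit.naturality f) (op n)) x
  dsimp at h
  simp only [realizationPoint]
  rw [h]
  rfl

/-- The morphism out of a realization determined by a compatible family of maps on simplices. -/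
noncomputable def realizationDesc {Z : TopCat.{u}}
    (φ : ∀ n : SimplexCategory, X.obj (op n) → C(stdSimplex ℝ (Fin (n.len + 1)), Z))
    (hφ : ∀ (m n : SimplexCategory) (f : m ⟶ n) (x : X.obj (op n))
      (t : stdSimplex ℝ (Fin (m.len + 1))), φ m (X.map f.op x) t = φ n x (stdSimplex.map f t)) :
    |X| ⟶ Z :=
  (sSetTopAdj.homEquiv X Z).symm
    { app n := ↾fun x ↦ (TopCat.toSSetObjEquiv Z n).symm (φ n.unop x)
      naturality m n f := by
        ext x
        apply (TopCat.toSSetObjEquiv Z n).injective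
        ext t
        exact (congrArg (fun g : C(_, Z) ↦ g t) ((TopCat.toSSetObjEquiv Z n).apply_symm_apply
          (φ n.unop (X.map f x)))).trans (hφ _ _ f.unop x t) }

lemma app_realizationPoint {Z : TopCat.{u}} (g : |X| ⟶ Z) {n : SimplexCategory}
    (x : X.obj (op n)) (t : stdSimplex ℝ (Fin (n.len + 1))) :
    g (realizationPoint x t) =
      TopCat.toSSetObjEquiv Z (op n) ((sSetTopAdj.homEquiv X Z g).app (op n) x) t := by
  rw [Adjunction.homEquiv_unit]
  rfl

@[simp]
lemma realizationDesc_realizationPoint {Z : TopCat.{u}}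
    (φ : ∀ n : SimplexCategory, X.obj (op n) → C(stdSimplex ℝ (Fin (n.len + 1)), Z))
    (hφ : ∀ (m n : SimplexCategory) (f : m ⟶ n) (x : X.obj (op n))
      (t : stdSimplex ℝ (Fin (m.len + 1))), φ m (X.map f.op x) t = φ n x (stdSimplex.map f t))
    {n : SimplexCategory} (x : X.obj (op n)) (t : stdSimplex ℝ (Fin (n.len + 1))) :
    realizationDesc φ hφ (realizationPoint x t) = φ n x t := by
  rw [app_realizationPoint, realizationDesc, Equiv.apply_symm_apply]
  exact congrArg (fun g : C(_, Z) ↦ g t) ((TopCat.toSSetObjEquiv Z (op n)).apply_symm_apply (φ n x))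

/-- By adjunction, a map out of |X| is a simplicial map to the singular set of Z, whose value at a
simplex is the restriction to that simplex. -/
lemma realization_hom_ext {Z : TopCat.{u}} {g h : |X| ⟶ Z}
    (w : ∀ (n : SimplexCategory) (x : X.obj (op n)) (t : stdSimplex ℝ (Fin (n.len + 1))),
      g (realizationPoint x t) = h (realizationPoint x t)) : g = h := by
  apply (sSetTopAdj.homEquiv X Z).injective
  ext n x
  apply (TopCat.toSSetObjEquiv Z n).injective
  ext t
  have := w n.unop x t
  rw [app_realizationPoint, app_realizationPoint] at this
  exact this

end GeometricRealization

end Realization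

/-! ### Triangulating the prism Δⁿ × I. -/

namespace stdSimplex

variable {n : ℕ}

/-- The sum of the barycentric coordinates of index less than `i`. -/
noncomputable def partialSum (t : stdSimplex ℝ (Fin (n + 1))) (i : ℕ) : ℝ :=
  ∑ a with a.val < i, t a

lemma continuous_partialSum (i : ℕ) :
    Continuous (fun t : stdSimplex ℝ (Fin (n + 1)) ↦ partialSum t i) :=
  continuous_finsetSum _ fun a _ ↦ (continuous_apply a).comp continuous_subtype_val

@[simp]
lemma partialSum_zero (t : stdSimplex ℝ (Fin (n + 1))) : partialSum t 0 = 0 := by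
  simp [partialSum]

lemma partialSum_succ (t : stdSimplex ℝ (Fin (n + 1))) (i : Fin (n + 1)) :
    partialSum t (i + 1) = partialSum t i + t i := by
  have : Finset.univ.filter (fun a : Fin (n + 1) ↦ a.val < i + 1) =
      insert i (Finset.univ.filter (fun a : Fin (n + 1) ↦ a.val < i)) := by
    ext a
    simp only [Finset.mem_filter, Finset.mem_univ, true_and, Finset.mem_insert, Fin.ext_iff]
    omega
  rw [partialSum, this, Finset.sum_insert (by simp), add_comm, partialSum]

lemma partialSum_mono (t : stdSimplex ℝ (Fin (n + 1))) : Monotone (partialSum t) :=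
  fun _ _ h ↦ Finset.sum_le_sum_of_subset_of_nonneg
    (fun _ ↦ by simpa using fun ha ↦ lt_of_lt_of_le ha h) (fun _ _ _ ↦ by simp)

@[simp]
lemma partialSum_top (t : stdSimplex ℝ (Fin (n + 1))) : partialSum t (n + 1) = 1 := by
  rw [partialSum, Finset.filter_true_of_mem (fun a _ ↦ a.isLt), sum_eq_one]

lemma map_apply {m : ℕ} (f : Fin (m + 1) → Fin (n + 1)) (t : stdSimplex ℝ (Fin (m + 1)))
    (b : Fin (n + 1)) : map f t b = ∑ a with f a = b, t a :=
  FunOnFinite.linearMap_apply_apply ..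

lemma partialSum_map {m : ℕ} (f : Fin (m + 1) → Fin (n + 1)) (t : stdSimplex ℝ (Fin (m + 1)))
    (i : ℕ) : partialSum (map f t) i = ∑ a with (f a).val < i, t a := by
  simp only [partialSum, map_apply, Finset.sum_filter (s := Finset.univ) (fun a ↦ f a = _)]
  rw [Finset.sum_comm, Finset.sum_filter]
  simp

/-- With `partialSum_succ_le_map`, this shows that `f` carries the `i`-th piece of a prism into the
`f i`-th. -/
lemma partialSum_map_le {m : ℕ} (f : Fin (m + 1) →o Fin (n + 1)) (t : stdSimplex ℝ (Fin (m + 1)))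
    (i : Fin (m + 1)) : partialSum (map f t) (f i) ≤ partialSum t i := by
  rw [partialSum_map]
  refine Finset.sum_le_sum_of_subset_of_nonneg (fun a ↦ ?_) (fun _ _ _ ↦ by simp)
  simp only [Finset.mem_filter, Finset.mem_univ, true_and, Fin.val_fin_lt]
  exact fun h ↦ lt_of_not_ge fun hi ↦ h.not_ge (f.monotone hi)

lemma partialSum_succ_le_map {m : ℕ} (f : Fin (m + 1) →o Fin (n + 1))
    (t : stdSimplex ℝ (Fin (m + 1))) (i : Fin (m + 1)) :
    partialSum t (i + 1) ≤ partialSum (map f t) (f i + 1) := by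
  rw [partialSum_map]
  refine Finset.sum_le_sum_of_subset_of_nonneg (fun a ↦ ?_) (fun _ _ _ ↦ by simp)
  simp only [Finset.mem_filter, Finset.mem_univ, true_and, Order.lt_add_one_iff, Fin.val_fin_le]
  exact fun h ↦ f.monotone h

/-- The part of the prism over the simplex that is covered by its `i`-th simplex. -/
def prismPiece (i : Fin (n + 1)) : Set (stdSimplex ℝ (Fin (n + 1)) × unitInterval) :=
  {p | partialSum p.1 i ≤ p.2 ∧ p.2 ≤ partialSum p.1 (i + 1)}

lemma isClosed_prismPiece (i : Fin (n + 1)) : IsClosed (prismPiece i) :=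
  (isClosed_le ((continuous_partialSum _).comp continuous_fst)
    (continuous_subtype_val.comp continuous_snd)).inter
  (isClosed_le (continuous_subtype_val.comp continuous_snd)
    ((continuous_partialSum _).comp continuous_fst))

lemma exists_mem_prismPiece (p : stdSimplex ℝ (Fin (n + 1)) × unitInterval) :
    ∃ i, p ∈ prismPiece i := by
  classical
  have h : ∃ k, (p.2 : ℝ) ≤ partialSum p.1 (k + 1) := ⟨n, by simpa using p.2.2.2⟩
  -- Minimality of this index gives the lower bound of the piece.
  have hn : Nat.find h ≤ n := Nat.find_le (by simpa using p.2.2.2)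
  refine ⟨⟨Nat.find h, by omega⟩, ?_, Nat.find_spec h⟩
  change partialSum p.1 (Nat.find h) ≤ p.2
  rcases hk : Nat.find h with _ | k
  · simpa using p.2.2.1
  · exact (lt_of_not_ge (Nat.find_min h (m := k) (by omega))).le

lemma iUnion_prismPiece : ⋃ i, prismPiece (n := n) i = Set.univ :=
  Set.iUnion_eq_univ_iff.2 exists_mem_prismPiece

/-- The barycentric coordinates of a point of a prism in the `i`-th simplex of the prism. -/
noncomputable def prismCoordFun (i : Fin (n + 1))
    (p : stdSimplex ℝ (Fin (n + 1)) × unitInterval) : Fin (n + 2) → ℝ :=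
  ⇑(map i.castSucc.succAbove p.1) +
    (p.2 - partialSum p.1 i) • (Pi.single i.castSucc 1 - Pi.single i.succ 1)

lemma map_succAbove_succAbove (i : Fin (n + 2)) (t : stdSimplex ℝ (Fin (n + 1)))
    (j : Fin (n + 1)) : map i.succAbove t (i.succAbove j) = t j := by
  rw [map_apply]
  simp [Finset.filter_eq']

lemma map_succAbove_self (i : Fin (n + 2)) (t : stdSimplex ℝ (Fin (n + 1))) :
    map i.succAbove t i = 0 := by
  rw [map_apply]
  simp [Fin.succAbove_ne]

/-- The coordinate `t i` is split into `s - partialSum t i` and `partialSum t (i + 1) - s`; the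
inequalities defining the piece say that both are nonnegative. -/
lemma prismCoordFun_mem {i : Fin (n + 1)} {p : stdSimplex ℝ (Fin (n + 1)) × unitInterval}
    (hp : p ∈ prismPiece i) : prismCoordFun i p ∈ stdSimplex ℝ (Fin (n + 2)) := by
  obtain ⟨h₁, h₂⟩ := hp
  refine ⟨fun j ↦ ?_, ?_⟩
  · rcases eq_or_ne j i.castSucc with rfl | hj
    · simp [prismCoordFun, -map_coe, map_succAbove_self, Fin.ext_iff, h₁]
    rcases eq_or_ne j i.succ with rfl | hj'
    · have := map_succAbove_succAbove i.castSucc p.1 i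
      rw [Fin.succAbove_castSucc_self] at this
      rw [partialSum_succ] at h₂
      simp [prismCoordFun, -map_coe, this, Fin.ext_iff]
      linarith
    · simp [prismCoordFun, -map_coe, hj, hj']
  · simp [prismCoordFun, -map_coe, Finset.sum_add_distrib, ← Finset.mul_sum]

/-- The barycentric coordinates of a point of a prism in the `i`-th simplex of the prism. -/
noncomputable def prismCoord (i : Fin (n + 1)) (p : prismPiece i) : stdSimplex ℝ (Fin (n + 2)) :=
  ⟨prismCoordFun i p.1, prismCoordFun_mem p.2⟩

lemma continuous_prismCoord (i : Fin (n + 1)) : Continuous (prismCoord i) := by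
  refine Continuous.subtype_mk ?_ _
  have h₁ : Continuous fun p : stdSimplex ℝ (Fin (n + 1)) × unitInterval ↦
      (⇑(map i.castSucc.succAbove p.1) : Fin (n + 2) → ℝ) :=
    continuous_subtype_val.comp ((continuous_map _).comp continuous_fst)
  have h₂ : Continuous fun p : stdSimplex ℝ (Fin (n + 1)) × unitInterval ↦
      (p.2 : ℝ) - partialSum p.1 i :=
    (continuous_subtype_val.comp continuous_snd).sub ((continuous_partialSum _).comp continuous_fst)
  exact (h₁.add (h₂.smul continuous_const)).comp continuous_subtype_val

lemma prismCoord_of_eq_partialSum (i : Fin (n + 1)) (p : prismPiece i)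
    (h : (p.1.2 : ℝ) = partialSum p.1.1 i) :
    prismCoord i p = map i.castSucc.succAbove p.1.1 := by
  ext j
  change prismCoordFun i p.1 j = _
  rw [prismCoordFun, h, sub_self, zero_smul, add_zero]

lemma prismCoord_of_eq_partialSum_succ (i : Fin (n + 1)) (p : prismPiece i)
    (h : (p.1.2 : ℝ) = partialSum p.1.1 (i + 1)) :
    prismCoord i p = map i.succ.succAbove p.1.1 := by
  ext j
  change prismCoordFun i p.1 j = _
  rw [prismCoordFun, h, partialSum_succ, add_sub_cancel_left]
  simp only [Pi.add_apply, Pi.smul_apply, Pi.sub_apply, map_apply, Finset.sum_filter, smul_eq_mul]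
  rw [← eq_sub_iff_add_eq', ← Finset.sum_sub_distrib, Finset.sum_eq_single i]
  · simp only [Fin.succAbove_castSucc_self, Fin.succAbove_succ_self, Pi.single_apply, eq_comm (a := j)]
    split_ifs <;> ring
  · intro a _ ha
    have : i.succ.succAbove a = i.castSucc.succAbove a := by
      rcases lt_or_gt_of_ne ha with ha | ha
      · rw [Fin.succAbove_succ_of_le _ _ ha.le, Fin.succAbove_castSucc_of_lt _ _ ha]
      · rw [Fin.succAbove_succ_of_lt _ _ ha, Fin.succAbove_castSucc_of_le _ _ ha.le]
    rw [this, sub_self]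
  · simp

/-- The map of prism simplices induced by a monotone map. -/
def prismHom {m : ℕ} (f : Fin (m + 1) →o Fin (n + 1)) (i : Fin (m + 1)) :
    Fin (m + 2) →o Fin (n + 2) where
  toFun j := if j ≤ i.castSucc then (f (i.predAbove j)).castSucc else (f (i.predAbove j)).succ
  monotone' a b hab := by
    have := f.monotone (Fin.predAbove_right_monotone i hab)
    dsimp only
    split_ifs <;> simp only [Fin.le_iff_val_le_val, Fin.val_castSucc, Fin.val_succ] at * <;> omega

lemma prismHom_apply {m : ℕ} (f : Fin (m + 1) →o Fin (n + 1)) (i : Fin (m + 1))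
    (j : Fin (m + 2)) : prismHom f i j =
      if j ≤ i.castSucc then (f (i.predAbove j)).castSucc else (f (i.predAbove j)).succ := rfl

lemma predAbove_le {m : ℕ} {i : Fin (m + 1)} {j : Fin (m + 2)} (h : j ≤ i.castSucc) :
    i.predAbove j ≤ i :=
  (Fin.predAbove_right_monotone i h).trans (Fin.predAbove_castSucc_self i).le

lemma le_predAbove {m : ℕ} {i : Fin (m + 1)} {j : Fin (m + 2)} (h : ¬ j ≤ i.castSucc) :
    i ≤ i.predAbove j :=
  (Fin.predAbove_castSucc_self i).ge.trans (Fin.predAbove_right_monotone i (le_of_not_ge h))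

/-- With `predAbove_prismHom`, this says that `prismHom f i` lifts `f × id` on [m] × [1] to the
`i`-th and `f i`-th prism simplices. -/
lemma prismHom_le_iff {m : ℕ} (f : Fin (m + 1) →o Fin (n + 1)) (i : Fin (m + 1))
    (j : Fin (m + 2)) : prismHom f i j ≤ (f i).castSucc ↔ j ≤ i.castSucc := by
  rw [prismHom_apply]
  split_ifs with h
  · simpa [h] using f.monotone (predAbove_le h)
  · have := f.monotone (le_predAbove h)
    simp only [h, iff_false, Fin.le_def, Fin.val_castSucc, Fin.val_succ] at *
    omega

lemma predAbove_prismHom {m : ℕ} (f : Fin (m + 1) →o Fin (n + 1)) (i : Fin (m + 1))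
    (j : Fin (m + 2)) : (f i).predAbove (prismHom f i j) = f (i.predAbove j) := by
  rw [prismHom_apply]
  split_ifs with h
  · exact Fin.predAbove_castSucc_of_le _ _ (f.monotone (predAbove_le h))
  · exact Fin.predAbove_succ_of_le _ _ (f.monotone (le_predAbove h))

lemma prismHom_castSucc {m : ℕ} (f : Fin (m + 1) →o Fin (n + 1)) (i : Fin (m + 1)) :
    prismHom f i i.castSucc = (f i).castSucc := by
  simp [prismHom_apply]

lemma prismHom_succ {m : ℕ} (f : Fin (m + 1) →o Fin (n + 1)) (i : Fin (m + 1)) :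
    prismHom f i i.succ = (f i).succ := by
  simp [prismHom_apply, Fin.le_iff_val_le_val]

lemma prismHom_succAbove {m : ℕ} (f : Fin (m + 1) →o Fin (n + 1)) (i a : Fin (m + 1)) :
    prismHom f i (i.castSucc.succAbove a) = if a < i then (f a).castSucc else (f a).succ := by
  split_ifs with h
  · rw [Fin.succAbove_castSucc_of_lt _ _ h]
    simp [prismHom_apply, h.le, Fin.predAbove_castSucc_of_le _ _ h.le]
  · rw [Fin.succAbove_castSucc_of_le _ _ (not_lt.1 h)]
    have : ¬ a.succ ≤ i.castSucc := by
      simp only [Fin.le_iff_val_le_val, Fin.lt_def, Fin.val_castSucc, Fin.val_succ] at *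
      omega
    simp [prismHom_apply, this, Fin.predAbove_succ_of_le _ _ (not_lt.1 h)]

lemma map_prismCoord {m : ℕ} (f : Fin (m + 1) →o Fin (n + 1)) (i : Fin (m + 1))
    (p : prismPiece i) (q : prismPiece (f i)) (h₁ : q.1.1 = map f p.1.1) (h₂ : q.1.2 = p.1.2) :
    map (prismHom f i) (prismCoord i p) = prismCoord (f i) q := by
  ext b
  change FunOnFinite.linearMap ℝ ℝ (prismHom f i) (prismCoordFun i p.1) b =
    prismCoordFun (f i) q.1 b
  rw [prismCoordFun, prismCoordFun, h₁, h₂, map_comp_apply, partialSum_map]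
  simp only [map_add, map_smul, map_sub, FunOnFinite.linearMap_piSingle, prismHom_castSucc,
    prismHom_succ, ← map_coe, map_comp_apply]
  simp only [Pi.add_apply, Pi.smul_apply, Pi.sub_apply, map_apply, Finset.sum_filter, smul_eq_mul,
    partialSum, Function.comp_apply, prismHom_succAbove, sub_mul, Finset.sum_mul]
  -- The terms in `s` agree, so the rest is compared vertex by vertex. The delicate vertices are `a
  -- < i` with `f a = f i`: they count in the partial sum of `t` but not in that of `map f t`.
  refine (add_sub_left_comm _ _ _).trans (Eq.trans ?_ (add_sub_left_comm _ _ _).symm)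
  rw [add_right_inj, ← Finset.sum_sub_distrib, ← Finset.sum_sub_distrib]
  refine Finset.sum_congr rfl fun a _ ↦ ?_
  simp only [Fin.val_fin_lt, Pi.single_apply, eq_comm (a := b)]
  by_cases ha : a < i
  · rcases (f.monotone ha.le).lt_or_eq with hf | hf
    · simp [ha, hf, Fin.succAbove_castSucc_of_lt]
    · simp only [ha, hf, Fin.succAbove_castSucc_self, if_true, lt_irrefl, if_false]
      split_ifs <;> ring
  · have hf : f i ≤ f a := f.monotone (not_lt.1 ha)
    simp [ha, hf.not_gt, Fin.succAbove_castSucc_of_le _ _ hf]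

end stdSimplex

/-! ### From simplicial homotopies to topological ones. -/

section Homotopy

open Simplicial Opposite MonoidalCategory

namespace GeometricRealization

open stdSimplex

variable {X Y : SSet.{u}}

/-- The morphism `⦋n + 1⦌ ⟶ ⦋1⦌` that jumps after `i`. -/
def prismStep {n : ℕ} (i : Fin (n + 1)) : ⦋n + 1⦌ ⟶ ⦋1⦌ :=
  SimplexCategory.mkHom
    { toFun j := if j ≤ i.castSucc then 0 else 1
      monotone' a b hab := by
        dsimp only
        split_ifs with h₁ h₂
        · exact le_rfl
        · exact Fin.zero_le _
        · exact absurd (hab.trans ‹_›) h₁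
        · exact le_rfl }

/-- The `i`-th simplex of the prism over the simplex `x`. -/
def prismSimplex (K : X ⊗ Δ[1] ⟶ Y) {n : ℕ} (x : X _⦋n⦌) (i : Fin (n + 1)) : Y _⦋n + 1⦌ :=
  K.app (op ⦋n + 1⦌) (X.map (SimplexCategory.σ i).op x,
    SSet.stdSimplex.objEquiv.symm (prismStep i))

lemma map_prismSimplex (K : X ⊗ Δ[1] ⟶ Y) {m n : ℕ} (x : X _⦋n⦌) (i : Fin (n + 1))
    (g : ⦋m⦌ ⟶ ⦋n + 1⦌) :
    Y.map g.op (prismSimplex K x i) =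
      K.app (op ⦋m⦌) (X.map (g ≫ SimplexCategory.σ i).op x,
        SSet.stdSimplex.objEquiv.symm (g ≫ prismStep i)) := by
  have h := ConcreteCategory.congr_hom (K.naturality g.op)
    ((X.map (SimplexCategory.σ i).op x, SSet.stdSimplex.objEquiv.symm (prismStep i)) :
      X _⦋n + 1⦌ × Δ[1] _⦋n + 1⦌)
  refine h.symm.trans ?_
  rw [op_comp, Functor.map_comp]
  rfl

/-- The point of the realization of `Y` determined by a point in the `i`-th simplex of a prism. -/
noncomputable def prismPoint (K : X ⊗ Δ[1] ⟶ Y) {n : ℕ} (x : X _⦋n⦌) (i : Fin (n + 1))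
    (p : prismPiece i) : |Y| :=
  realizationPoint (prismSimplex K x i) (prismCoord i p)

lemma continuous_prismPoint (K : X ⊗ Δ[1] ⟶ Y) {n : ℕ} (x : X _⦋n⦌) (i : Fin (n + 1)) :
    Continuous (prismPoint K x i) :=
  (continuous_realizationPoint _).comp (continuous_prismCoord i)

lemma prismPoint_map (K : X ⊗ Δ[1] ⟶ Y) {m n : ℕ} (x : X _⦋n⦌) (f : ⦋m⦌ ⟶ ⦋n⦌)
    (i : Fin (m + 1)) (p : prismPiece i) (q : prismPiece (f i)) (h₁ : q.1.1 = map f p.1.1)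
    (h₂ : q.1.2 = p.1.2) :
    prismPoint K (X.map f.op x) i p = prismPoint K x (f i) q := by
  let g : ⦋m + 1⦌ ⟶ ⦋n + 1⦌ := SimplexCategory.mkHom (prismHom f.toOrderHom i)
  have hg : prismSimplex K (X.map f.op x) i = Y.map g.op (prismSimplex K x (f i)) := by
    rw [map_prismSimplex, prismSimplex]
    have h₃ : SimplexCategory.σ i ≫ f = g ≫ SimplexCategory.σ (f i) := by
      ext j : 3
      exact (predAbove_prismHom f.toOrderHom i j).symm
    have h₄ : prismStep i = g ≫ prismStep (f i) := by
      ext j : 3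
      change (if j ≤ i.castSucc then 0 else 1) =
        if prismHom f.toOrderHom i j ≤ (f i).castSucc then 0 else 1
      exact (if_congr (prismHom_le_iff f.toOrderHom i j) rfl rfl).symm
    rw [← h₃, ← h₄, op_comp, Functor.map_comp]
    rfl
  rw [prismPoint, hg, realizationPoint_map]
  exact congrArg _ (map_prismCoord f.toOrderHom i p q h₁ h₂)

/-- Consecutive pieces meet where `s = partialSum t (i + 1)`, which is the common face opposite
vertex `i + 1` of both simplices. -/
lemma prismPoint_eq_of_succ (K : X ⊗ Δ[1] ⟶ Y) {n : ℕ} (x : X _⦋n⦌) {i j : Fin (n + 1)}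
    (hij : j.val = i.val + 1) (p) (hi : p ∈ prismPiece i) (hj : p ∈ prismPiece j) :
    prismPoint K x i ⟨p, hi⟩ = prismPoint K x j ⟨p, hj⟩ := by
  have h : (p.2 : ℝ) = partialSum p.1 (i + 1) := le_antisymm hi.2 (hij ▸ hj.1)
  have hs : i.succ = j.castSucc := Fin.ext (by simp [hij])
  rw [prismPoint, prismPoint, prismCoord_of_eq_partialSum_succ i _ h,
    prismCoord_of_eq_partialSum j _ (by rw [h, hij])]
  have h₁ := realizationPoint_map (SimplexCategory.δ i.succ) (prismSimplex K x i) p.1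
  have h₂ := realizationPoint_map (SimplexCategory.δ j.castSucc) (prismSimplex K x j) p.1
  refine h₁.symm.trans (Eq.trans ?_ h₂)
  rw [map_prismSimplex, map_prismSimplex, SimplexCategory.δ_comp_σ_self,
    SimplexCategory.δ_comp_σ_succ]
  congr 4
  ext k : 3
  change (if i.succ.succAbove k ≤ i.castSucc then 0 else 1) =
    if j.castSucc.succAbove k ≤ j.castSucc then 0 else 1
  refine if_congr ?_ rfl rfl
  simp only [Fin.succAbove, Fin.lt_def, Fin.le_def]
  split_ifs <;> simp only [Fin.val_castSucc, Fin.val_succ] at * <;> omega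

lemma prismPoint_eq (K : X ⊗ Δ[1] ⟶ Y) {n : ℕ} (x : X _⦋n⦌) {i j : Fin (n + 1)}
    (p) (hi : p ∈ prismPiece i) (hj : p ∈ prismPiece j) :
    prismPoint K x i ⟨p, hi⟩ = prismPoint K x j ⟨p, hj⟩ := by
  wlog hij : i ≤ j generalizing i j
  · exact (this hj hi (le_of_not_ge hij)).symm
  obtain ⟨d, hd⟩ := Nat.exists_eq_add_of_le (Fin.le_def.1 hij)
  induction d generalizing i with
  | zero =>
    obtain rfl : j = i := Fin.ext hd
    rfl
  | succ d ih =>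
    let k : Fin (n + 1) := ⟨i + 1, by omega⟩
    -- A point of two pieces lies in every piece between them.
    have hk : p ∈ prismPiece k :=
      ⟨(partialSum_mono p.1 (show i.val + 1 ≤ j by omega)).trans hj.1,
        hi.2.trans (partialSum_mono p.1 (Nat.le_succ _))⟩
    exact (prismPoint_eq_of_succ K x rfl p hi hk).trans
      (ih hk (Fin.le_def.2 (by simp only [k]; omega)) (by simp only [k]; omega))

/-- The map from the prism over a simplex `x` to the realization of `Y`. -/
noncomputable def prismMap (K : X ⊗ Δ[1] ⟶ Y) {n : ℕ} (x : X _⦋n⦌) :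
    C(stdSimplex ℝ (Fin (n + 1)) × unitInterval, |Y|) where
  toFun p := prismPoint K x _ ⟨p, (exists_mem_prismPiece p).choose_spec⟩
  continuous_toFun := by
    refine (locallyFinite_of_finite (prismPiece (n := n))).continuous iUnion_prismPiece
      isClosed_prismPiece fun i ↦ continuousOn_iff_continuous_domRestrict.2 ?_
    convert continuous_prismPoint K x i using 1
    ext p
    exact prismPoint_eq K x p.1 _ p.2

lemma prismMap_eq (K : X ⊗ Δ[1] ⟶ Y) {n : ℕ} (x : X _⦋n⦌) {i : Fin (n + 1)} (p)
    (hp : p ∈ prismPiece i) : prismMap K x p = prismPoint K x i ⟨p, hp⟩ :=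
  prismPoint_eq K x p _ hp

lemma prismMap_map (K : X ⊗ Δ[1] ⟶ Y) {m n : ℕ} (x : X _⦋n⦌) (f : ⦋m⦌ ⟶ ⦋n⦌)
    (t : stdSimplex ℝ (Fin (m + 1))) (s : unitInterval) :
    prismMap K (X.map f.op x) (t, s) = prismMap K x (map f t, s) := by
  obtain ⟨i, hi⟩ := exists_mem_prismPiece (t, s)
  have hfi : (map f t, s) ∈ prismPiece (f i) :=
    ⟨(partialSum_map_le f.toOrderHom t i).trans hi.1,
      hi.2.trans (partialSum_succ_le_map f.toOrderHom t i)⟩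
  rw [prismMap_eq K _ _ hi, prismMap_eq K _ _ hfi]
  exact prismPoint_map K x f i ⟨_, hi⟩ ⟨_, hfi⟩ rfl rfl

/-- The parameter `s` is the weight of vertex 0 of Δ[1], so time 0 corresponds to `ι₁` and time 1 to
`ι₀`. -/
lemma prismMap_zero (K : X ⊗ Δ[1] ⟶ Y) {n : ℕ} (x : X _⦋n⦌) (t : stdSimplex ℝ (Fin (n + 1))) :
    prismMap K x (t, 0) = realizationPoint ((SSet.ι₁ ≫ K).app (op ⦋n⦌) x) t := by
  have h : (t, 0) ∈ prismPiece (0 : Fin (n + 1)) := ⟨by simp, Finset.sum_nonneg (by simp)⟩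
  rw [prismMap_eq K x _ h, prismPoint, prismCoord_of_eq_partialSum _ _ (by simp)]
  refine (realizationPoint_map (SimplexCategory.δ (Fin.castSucc 0))
    (prismSimplex K x 0) t).symm.trans ?_
  rw [map_prismSimplex, SimplexCategory.δ_comp_σ_self, op_id, X.map_id]
  congr 1

lemma prismMap_one (K : X ⊗ Δ[1] ⟶ Y) {n : ℕ} (x : X _⦋n⦌) (t : stdSimplex ℝ (Fin (n + 1))) :
    prismMap K x (t, 1) = realizationPoint ((SSet.ι₀ ≫ K).app (op ⦋n⦌) x) t := by
  have h : (t, 1) ∈ prismPiece (Fin.last n) :=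
    ⟨(partialSum_mono t (Nat.le_succ _)).trans (by simp), by simp⟩
  rw [prismMap_eq K x _ h, prismPoint, prismCoord_of_eq_partialSum_succ _ _ (by simp)]
  refine (realizationPoint_map (SimplexCategory.δ (Fin.succ (Fin.last n)))
    (prismSimplex K x (Fin.last n)) t).symm.trans ?_
  rw [map_prismSimplex, SimplexCategory.δ_comp_σ_succ, op_id, X.map_id]
  congr 1
  change K.app _ _ = K.app _ _
  congr 1
  refine Prod.ext rfl ?_
  apply SSet.stdSimplex.objEquiv.injective
  rw [Equiv.apply_symm_apply]
  ext k : 3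
  change (if (Fin.last n).succ.succAbove k ≤ (Fin.last n).castSucc then (0 : Fin 2) else 1) = 0
  rw [Fin.succ_last, Fin.succAbove_last, if_pos]
  exact Fin.castSucc_le_castSucc_iff.2 (Fin.le_last k)

/-- A simplicial homotopy induces a map from the realization of the source to the space of paths
in the realization of the target. -/
noncomputable def realizationPaths (K : X ⊗ Δ[1] ⟶ Y) :
    |X| ⟶ TopCat.of C(unitInterval, |Y|) :=
  realizationDesc (fun n x ↦ (prismMap K (n := n.len) x).curry)
    (fun m n f x t ↦ ContinuousMap.ext fun s ↦ prismMap_map K (m := m.len) (n := n.len) x f t s)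

/-- The realizations of simplicially homotopic maps are homotopic. -/
theorem homotopic_toTop_map (K : X ⊗ Δ[1] ⟶ Y) :
    (SSet.toTop.map (SSet.ι₁ ≫ K)).hom.Homotopic (SSet.toTop.map (SSet.ι₀ ≫ K)).hom := by
  have key (s : unitInterval) (L : X ⟶ Y)
      (h : ∀ (n : ℕ) (x : X _⦋n⦌) t, prismMap K x (t, s) = realizationPoint (L.app (op ⦋n⦌) x) t)
      (z : |X|) : (realizationPaths K z : C(unitInterval, |Y|)) s = SSet.toTop.map L z := by
    have : realizationPaths K ≫ TopCat.ofHom (Y := |Y|)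
        ⟨fun γ : C(unitInterval, |Y|) ↦ γ s, continuous_eval_const s⟩ =
          SSet.toTop.map L := by
      refine realization_hom_ext fun n x t ↦ ?_
      rw [toTop_map_realizationPoint]
      refine Eq.trans ?_ (h n.len x t)
      exact congrArg (fun γ : C(unitInterval, |Y|) ↦ γ s) (realizationDesc_realizationPoint
        (Z := TopCat.of C(unitInterval, |Y|)) _ _ x t)
    exact ConcreteCategory.congr_hom this z
  exact ⟨{
    toFun p := (realizationPaths K p.2 : C(unitInterval, |Y|)) p.1
    -- Evaluation of paths is jointly continuous because the interval is locally compact.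
    continuous_toFun := ContinuousEval.continuous_eval.comp
      (((realizationPaths K).hom.continuous.comp continuous_snd).prodMk continuous_fst)
    map_zero_left := key 0 _ fun n x t ↦ prismMap_zero K x t
    map_one_left := key 1 _ fun n x t ↦ prismMap_one K x t }⟩

end GeometricRealization

end Homotopy

/-! ### Natural transformations and constant functors on classifying spaces. -/

section Nerve

open Simplicial Opposite MonoidalCategory

namespace GeometricRealization

variable {C D : Type u} [Category.{v} C] [Category.{v} D]

/-- The simplicial homotopy induced by a natural transformation. -/
noncomputable def nerveHomotopy {F G : C ⥤ D} (α : F ⟶ G) : nerve C ⊗ Δ[1] ⟶ nerve D where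
  app _ := ↾fun x ↦ Functor.prod'
    (SSet.stdSimplex.objEquiv x.2).toOrderHom.monotone.functor (x.1 : ComposableArrows C _) ⋙
      Functor.uncurry.obj (ComposableArrows.mk₁ α)
  naturality _ _ _ := rfl

lemma ι₀_nerveHomotopy {F G : C ⥤ D} (α : F ⟶ G) :
    SSet.ι₀ ≫ nerveHomotopy α = nerveMap F := by
  ext n x
  refine CategoryTheory.Functor.ext (fun _ ↦ rfl) fun i j f ↦ ?_
  change 𝟙 (F.obj (x.obj i)) ≫ F.map (x.map f) = eqToHom rfl ≫ F.map (x.map f) ≫ eqToHom rfl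
  simp

lemma ι₁_nerveHomotopy {F G : C ⥤ D} (α : F ⟶ G) :
    SSet.ι₁ ≫ nerveHomotopy α = nerveMap G := by
  ext n x
  refine CategoryTheory.Functor.ext (fun _ ↦ rfl) fun i j f ↦ ?_
  change 𝟙 (G.obj (x.obj i)) ≫ G.map (x.map f) = eqToHom rfl ≫ G.map (x.map f) ≫ eqToHom rfl
  simp

/-- A natural transformation induces a homotopy between the maps of classifying spaces. -/
theorem homotopic_of_natTrans {F G : C ⥤ D} (α : F ⟶ G) :
    (SSet.toTop.map (nerveMap G)).hom.Homotopic (SSet.toTop.map (nerveMap F)).hom := by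
  rw [← ι₀_nerveHomotopy α, ← ι₁_nerveHomotopy α]
  exact homotopic_toTop_map _

/-- The nerve of a constant functor realizes to a constant map. -/
lemma toTop_map_nerveMap_const (d : D) :
    ∃ y, (SSet.toTop.map (nerveMap ((Functor.const C).obj d))).hom =
      ContinuousMap.const _ y := by
  refine ⟨realizationPoint (n := ⦋0⦌) (ComposableArrows.mk₀ d) default, ?_⟩
  have : SSet.toTop.map (nerveMap ((Functor.const C).obj d)) = TopCat.ofHom (ContinuousMap.const _
      (realizationPoint (X := nerve D) (n := ⦋0⦌) (ComposableArrows.mk₀ d) default)) := by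
    refine realization_hom_ext fun n x t ↦ ?_
    rw [toTop_map_realizationPoint]
    have h := realizationPoint_map (X := nerve D) (SimplexCategory.const n ⦋0⦌ 0)
      (ComposableArrows.mk₀ d) t
    -- Every simplex in the image is a degeneracy of the vertex `d`, and Δ⁰ is a single point.
    rw [Subsingleton.elim (stdSimplex.map _ t) default] at h
    refine Eq.trans ?_ h
    congr 1
  rw [this]
  rfl

/-- A category whose identity functor is homotopic to a constant functor after realization is
contractible. -/
theorem isContractibleCategory_of_homotopic {C : Type u} [Category.{v} C] (c : C)
    (h : (SSet.toTop.map (nerveMap (𝟭 C))).hom.Homotopic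
      (SSet.toTop.map (nerveMap ((Functor.const C).obj c))).hom) :
    IsContractibleCategory C := by
  obtain ⟨y, hy⟩ := toTop_map_nerveMap_const (C := C) c
  have hid : nerveMap (𝟭 C) = 𝟙 (nerve C) := rfl
  rw [hy, hid, CategoryTheory.Functor.map_id] at h
  exact (contractible_iff_id_nullhomotopic _).2 ⟨y, h⟩

end GeometricRealization

end Nerve

theorem mainTheorem11 (C : Type u) [Category.{v} C] [Nonempty C] :
    (HasBinaryCoproducts C → IsContractibleCategory C) ∧
      (HasBinaryProducts C → IsContractibleCategory C) := by
  obtain ⟨c⟩ := ‹Nonempty C›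
  refine ⟨fun _ ↦ ?_, fun _ ↦ ?_⟩
  · have α : 𝟭 C ⟶ coprod.functor.obj c := {
      app X := coprod.inr
      naturality X Y f := (coprod.inr_map (𝟙 c) f).symm }
    have β : (Functor.const C).obj c ⟶ coprod.functor.obj c := {
      app X := coprod.inl
      naturality X Y f := (coprod.inl_map (𝟙 c) f).symm }
    exact GeometricRealization.isContractibleCategory_of_homotopic c
      ((GeometricRealization.homotopic_of_natTrans α).symm.trans
        (GeometricRealization.homotopic_of_natTrans β))
  · have α : prod.functor.obj c ⟶ 𝟭 C := {
      app X := prod.snd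
      naturality X Y f := prod.map_snd (𝟙 c) f }
    have β : prod.functor.obj c ⟶ (Functor.const C).obj c := {
      app X := prod.fst
      naturality X Y f := prod.map_fst (𝟙 c) f }
    exact GeometricRealization.isContractibleCategory_of_homotopic c
      ((GeometricRealization.homotopic_of_natTrans α).trans
        (GeometricRealization.homotopic_of_natTrans β).symm)
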